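/- For every $\varepsilon_0<1$ there is a constant $c>0$, depending on nothing but $\varepsilon_0$, such that the following holds (in particular, fixing for instance $\varepsilon_0=1/2$, there is a universal constant $c>0$ for all $0<\varepsilon\le 1/2$). For every $0<\varepsilon\le\varepsilon_0$, every $n$ and all points $x_1,\dots,x_n\in\mathbb{R}^2$ (not necessarily distinct) with $\|x_i-x_j\|\le 1$ for all $i,j$, $$\#\{1\le i,j\le n:\ \|x_i-x_j\|\le\varepsilon\}\ \ge\ \frac{c\,\varepsilon^{3/4}}{(\log\varepsilon^{-1})^{1/4}}\cdot\#\{1\le i,j\le n:\ \|x_i-x_j\|\ge 1-\varepsilon\},$$ where both counts are over ordered pairs $(i,j)$ (with $i=j$ allowed) and $\|\cdot\|$ is the Euclidean norm. -/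

import Mathlib

/-! Cut the plane into cells of side `ε / 2`; points sharing a cell are at distance at most `ε`. If
cell `b` holds `μ b` points, there are at least `∑ μ b ^ 2` near pairs, while by Cauchy–Schwarz the
far pairs number at most the square root of the number of cell pairs they realise, times `∑ μ b ^
2`. So it suffices to bound the realised cell pairs by a multiple of `ε ^ (-3/2)`.

That bound is geometric. Two almost-diameters with the same direction up to `ε` have first endpoints
within `O(√ε)` of each other, and once these agree to `O(ε)` in one coordinate they do so in the
other (`near_diameters_close`). There are `O(1 / ε)` directions and `O(1 / √ε)` positions
(`card_far_gridCell_pairs_le`).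

This yields the factor `ε ^ (3/4)` with no logarithm; the logarithm is bounded below for `ε ≤ ε₀`,
so dividing by it costs only a constant. -/

/-! ### Counting pairs through a colouring. -/

open Finset in
/-- If the values of `g` determine those of `f` on `R`, then `f` takes at most as many values
as `g` does. -/
theorem card_image_le_of_determined {α β γ : Type*} [DecidableEq β] (R : Finset α)
    (f : α → β) (g : α → γ) (T : Finset γ) (hT : ∀ p ∈ R, g p ∈ T)
    (h : ∀ p ∈ R, ∀ p' ∈ R, g p = g p' → f p = f p') : #(R.image f) ≤ #T := by
  classical
  have hex : ∀ b ∈ R.image f, ∃ p ∈ R, f p = b := fun b hb => Finset.mem_image.1 hb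
  rcases R.eq_empty_or_nonempty with rfl | ⟨p₀, -⟩
  · simp
  have : Nonempty α := ⟨p₀⟩
  choose! r hr hfr using hex
  refine Finset.card_le_card_of_injOn (fun b => g (r b)) (fun b hb => hT _ (hr b hb)) ?_
  intro b hb b' hb' hbb
  rw [← hfr b hb, ← hfr b' hb']
  exact h _ (hr b hb) _ (hr b' hb') hbb

open Finset in
/-- The number of pairs in `R` is controlled by the number of pairs with equal colours and the
number of colour pairs which `R` realises. -/
theorem sq_card_le_card_image_mul {α β : Type*} [Fintype α] [DecidableEq β] (Q : α → β)
    (R : Finset (α × α)) :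
    (#R) ^ 2 ≤ #(R.image (Prod.map Q Q)) * (#{p : α × α | Q p.1 = Q p.2}) ^ 2 := by
  classical
  set μ : β → ℕ := fun b => #{i : α | Q i = b}
  set A := R.image (Prod.map Q Q)
  set I := (univ : Finset α).image Q
  have h1 : #R ≤ ∑ e ∈ A, μ e.1 * μ e.2 := by
    rw [Finset.card_eq_sum_card_image (Prod.map Q Q) R]
    refine Finset.sum_le_sum fun e _ => ?_
    rw [← Finset.card_product]
    refine Finset.card_le_card fun p hp => ?_
    simp only [mem_filter, mem_product, mem_univ, true_and] at hp ⊢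
    rw [← hp.2]
    simp
  have h2 : ∑ b ∈ I, μ b ^ 2 = #{p : α × α | Q p.1 = Q p.2} := by
    rw [Finset.card_eq_sum_card_fiberwise (f := fun p : α × α => Q p.1) (t := I)
      (fun p _ => by simp [I])]
    refine Finset.sum_congr rfl fun b _ => ?_
    rw [sq, ← Finset.card_product]
    congr 1
    ext p
    simp only [mem_filter, mem_product, mem_univ, true_and]
    constructor
    · rintro ⟨h, h'⟩
      exact ⟨h.trans h'.symm, h⟩
    · rintro ⟨h, h'⟩
      exact ⟨h', h ▸ h'⟩
  have h3 : A ⊆ I ×ˢ I := by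
    intro e he
    obtain ⟨p, _, rfl⟩ := Finset.mem_image.1 he
    simp [I]
  -- Cauchy–Schwarz over `A`; enlarging `A` to `I ×ˢ I` makes the sum of squares factor.
  calc (#R) ^ 2 ≤ (∑ e ∈ A, μ e.1 * μ e.2) ^ 2 := Nat.pow_le_pow_left h1 2
    _ ≤ #A * ∑ e ∈ A, (μ e.1 * μ e.2) ^ 2 := sq_sum_le_card_mul_sum_sq
    _ ≤ #A * ∑ e ∈ I ×ˢ I, (μ e.1 * μ e.2) ^ 2 :=
        Nat.mul_le_mul_left _ (Finset.sum_le_sum_of_subset h3)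
    _ = #A * (∑ b ∈ I, μ b ^ 2) ^ 2 := by
        rw [Finset.sum_product, sq (∑ b ∈ I, μ b ^ 2), Finset.sum_mul_sum]
        simp only [mul_pow]
    _ = _ := by rw [h2]

/-! ### Geometry of two almost-diameters. -/

/-- Two segments of length almost `1` with close direction vectors `(p, q)` and `(P, W)`, whose
endpoints span a set of diameter at most `1`, are close to each other, and closer still in the
direction of the segments. Here `(d₁, d₂)` is the difference of their first endpoints. -/
theorem near_diameters_close {ε p q P W d₁ d₂ : ℝ} (hε : 0 < ε) (hε' : ε ≤ 1 / 8)
    (hqp : |q| ≤ |p|) (hWP : |W| ≤ |P|) (hsign : 0 ≤ p ↔ 0 ≤ P) (hqW : |q - W| ≤ ε)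
    (h1 : (1 - ε) ^ 2 ≤ q ^ 2 + p ^ 2) (h2 : q ^ 2 + p ^ 2 ≤ 1)
    (h3 : (1 - ε) ^ 2 ≤ W ^ 2 + P ^ 2) (h4 : W ^ 2 + P ^ 2 ≤ 1)
    (h5 : d₂ ^ 2 + d₁ ^ 2 ≤ 1) (h6 : (d₂ + W) ^ 2 + (d₁ + P) ^ 2 ≤ 1)
    (h7 : (q - d₂) ^ 2 + (p - d₁) ^ 2 ≤ 1) :
    |p - P| ≤ 4 * ε ∧ d₂ ^ 2 ≤ 7 * ε ∧ (|d₂| ≤ ε → |d₁| ≤ 14 * ε) := by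
  have h1' : 1 - 2 * ε ≤ q ^ 2 + p ^ 2 := by linarith [sq_nonneg ε]
  have h3' : 1 - 2 * ε ≤ W ^ 2 + P ^ 2 := by linarith [sq_nonneg ε]
  have hp : 1 / 2 ≤ |p| := by
    have : (1 / 2) ^ 2 ≤ p ^ 2 := by linarith [sq_le_sq.2 hqp]
    simpa using sq_le_sq.1 this
  have hP : 1 / 2 ≤ |P| := by
    have : (1 / 2) ^ 2 ≤ P ^ 2 := by linarith [sq_le_sq.2 hWP]
    simpa using sq_le_sq.1 this
  have hq1 : |q| ≤ 1 := (sq_le_one_iff_abs_le_one q).1 (by linarith [sq_nonneg p])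
  have hW1 : |W| ≤ 1 := (sq_le_one_iff_abs_le_one W).1 (by linarith [sq_nonneg P])
  have hd1 : |d₁| ≤ 1 := (sq_le_one_iff_abs_le_one d₁).1 (by linarith [sq_nonneg d₂])
  have hd2 : |d₂| ≤ 1 := (sq_le_one_iff_abs_le_one d₂).1 (by linarith [sq_nonneg d₁])
  -- The major coordinates have equal sign and size at least `1 / 2`, so a bound on `p ^ 2 - P ^ 2`
  -- passes to `p - P`.
  have hsum : 1 ≤ |p + P| := by
    by_cases h : 0 ≤ p
    · have h' := hsign.1 h
      rw [abs_of_nonneg h] at hp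
      rw [abs_of_nonneg h'] at hP
      rw [abs_of_nonneg (by linarith)]
      linarith
    · have h' : ¬ 0 ≤ P := fun h' => h (hsign.2 h')
      rw [not_le] at h h'
      rw [abs_of_neg h] at hp
      rw [abs_of_neg h'] at hP
      rw [abs_of_neg (by linarith)]
      linarith
  have hqW2 : |q ^ 2 - W ^ 2| ≤ 2 * ε := by
    rw [sq_sub_sq, abs_mul]
    exact mul_le_mul ((abs_add_le q W).trans (by linarith)) hqW (abs_nonneg _) (by norm_num)
  have hpP : |p - P| ≤ 4 * ε := by
    have : |p + P| * |p - P| ≤ 4 * ε := by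
      rw [← abs_mul, ← sq_sub_sq, abs_le]
      rw [abs_le] at hqW2
      constructor <;> linarith
    exact (le_mul_of_one_le_left (abs_nonneg _) hsum).trans this
  have hA : |d₁ * (p - P)| ≤ 4 * ε := by
    rw [abs_mul]
    exact (mul_le_of_le_one_left (abs_nonneg _) hd1).trans hpP
  have hB : |d₂ * (q - W)| ≤ ε := by
    rw [abs_mul]
    exact (mul_le_of_le_one_left (abs_nonneg _) hd2).trans hqW
  rw [abs_le] at hA hB
  -- The two cross distances are at most `1`, which bounds the inner product of `d` with `(P, W)`
  -- from both sides; adding the bounds leaves `d₁ ^ 2 + d₂ ^ 2 ≤ 7 * ε`.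
  have h6' : 2 * (d₁ * P + d₂ * W) ≤ 2 * ε - d₁ ^ 2 - d₂ ^ 2 := by linarith
  have h7' : -(2 * (d₁ * P + d₂ * W)) ≤
      2 * ε - d₁ ^ 2 - d₂ ^ 2 + 2 * (d₁ * (p - P)) + 2 * (d₂ * (q - W)) := by linarith
  have hsq₁ := sq_nonneg d₁
  have hsq₂ := sq_nonneg d₂
  refine ⟨hpP, by linarith, fun hd => ?_⟩
  have hD : |d₂ * W| ≤ ε := by
    rw [abs_mul]
    exact (mul_le_of_le_one_right (abs_nonneg _) hW1).trans hd
  rw [abs_le] at hD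
  have hF : |d₁ * P| ≤ 7 * ε := by
    rw [abs_le]
    constructor <;> linarith
  rw [abs_mul] at hF
  have := mul_le_mul_of_nonneg_left hP (abs_nonneg d₁)
  linarith

/-! ### Grid cells. -/

theorem EuclideanSpace.norm_sq_eq_add_rev (v : EuclideanSpace ℝ (Fin 2)) (s : Fin 2) :
    ‖v‖ ^ 2 = v s ^ 2 + v s.rev ^ 2 := by
  rw [EuclideanSpace.norm_sq_eq, Fin.sum_univ_two]
  fin_cases s
  · simp [Fin.rev]
  · simp [Fin.rev, add_comm]

theorem EuclideanSpace.abs_apply_le_norm (v : EuclideanSpace ℝ (Fin 2)) (s : Fin 2) :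
    |v s| ≤ ‖v‖ := by
  simpa using PiLp.norm_apply_le v s

/-- The cell of side `δ` which contains `v`. -/
noncomputable def gridCell (δ : ℝ) (v : EuclideanSpace ℝ (Fin 2)) (s : Fin 2) : ℤ :=
  ⌊v s / δ⌋

theorem abs_floor_div_sub_floor_div_lt {δ a b C : ℝ} (hδ : 0 < δ) (h : |a - b| ≤ C * δ) :
    |((⌊a / δ⌋ - ⌊b / δ⌋ : ℤ) : ℝ)| < C + 1 := by
  have h' : |a / δ - b / δ| ≤ C := by
    rw [← sub_div, abs_div, abs_of_pos hδ, div_le_iff₀ hδ]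
    exact h
  rw [abs_le] at h'
  push_cast
  rw [abs_lt]
  constructor <;>
    linarith [Int.floor_le (a / δ), Int.floor_le (b / δ), Int.lt_floor_add_one (a / δ),
      Int.lt_floor_add_one (b / δ)]

theorem abs_sub_lt_of_floor_div_eq {δ a b : ℝ} (hδ : 0 < δ) (h : ⌊a / δ⌋ = ⌊b / δ⌋) :
    |a - b| < δ := by
  have := Int.abs_sub_lt_one_of_floor_eq_floor h
  rwa [← sub_div, abs_div, abs_of_pos hδ, div_lt_one hδ] at this

/-- Integers confined to a short window of unknown position are encoded by residues, so no origin
has to be chosen. -/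
theorem Int.eq_of_emod_eq_of_abs_sub_lt {a b : ℤ} {N : ℕ} {C : ℝ} (h : a % N = b % N)
    (hC : |((a - b : ℤ) : ℝ)| < C) (hCN : C ≤ N) : a = b := by
  have hlt : |a - b| < (N : ℤ) := by
    have : |((a - b : ℤ) : ℝ)| < (N : ℝ) := hC.trans_le hCN
    exact_mod_cast this
  have := Int.eq_zero_of_abs_lt_dvd (Int.ModEq.dvd (Int.ModEq.symm h)) hlt
  omega

theorem norm_sub_le_of_gridCell_eq {ε : ℝ} (hε : 0 < ε) {v w : EuclideanSpace ℝ (Fin 2)}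
    (h : gridCell (ε / 2) v = gridCell (ε / 2) w) : ‖v - w‖ ≤ ε := by
  have h0 := abs_sub_lt_of_floor_div_eq (half_pos hε) (congrFun h 0)
  have h1 := abs_sub_lt_of_floor_div_eq (half_pos hε) (congrFun h 1)
  refine abs_le_of_sq_le_sq' ?_ hε.le |>.2
  rw [EuclideanSpace.norm_sq_eq_add_rev _ 0]
  have e : (0 : Fin 2).rev = 1 := rfl
  rw [e, PiLp.sub_apply, PiLp.sub_apply]
  nlinarith [sq_lt_sq' (abs_lt.1 h0).1 (abs_lt.1 h0).2, sq_lt_sq' (abs_lt.1 h1).1 (abs_lt.1 h1).2]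

open Finset in
theorem card_far_le {ε : ℝ} (hε : 0 < ε) {n : ℕ} (x : Fin n → EuclideanSpace ℝ (Fin 2))
    (R : Finset (Fin n × Fin n)) {K : ℝ} (hK : 0 ≤ K)
    (hRK : (#(R.image (Prod.map (fun i => gridCell (ε / 2) (x i))
      fun i => gridCell (ε / 2) (x i))) : ℝ) ≤ K ^ 2) :
    (#R : ℝ) ≤ K * ({p : Fin n × Fin n | ‖x p.1 - x p.2‖ ≤ ε}.ncard : ℝ) := by
  classical
  set Q : Fin n → Fin 2 → ℤ := fun i => gridCell (ε / 2) (x i)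
  have h := sq_card_le_card_image_mul Q R
  have hS : #{p : Fin n × Fin n | Q p.1 = Q p.2} ≤
      {p : Fin n × Fin n | ‖x p.1 - x p.2‖ ≤ ε}.ncard := by
    rw [← Set.ncard_coe_finset]
    refine Set.ncard_le_ncard (fun p hp => ?_) (Set.toFinite _)
    simp only [coe_filter, mem_univ, true_and, Set.mem_ofPred_eq] at hp
    exact norm_sub_le_of_gridCell_eq hε hp
  refine abs_le_of_sq_le_sq' ?_ (by positivity) |>.2
  rw [mul_pow]
  calc (#R : ℝ) ^ 2 ≤ #(R.image (Prod.map Q Q)) *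
        (#{p : Fin n × Fin n | Q p.1 = Q p.2} : ℝ) ^ 2 := by exact_mod_cast h
    _ ≤ _ := by gcongr

open Finset in
/-- A set of diameter at most `1` meets boundedly many cells. -/
theorem card_gridCell_pairs_le {ε : ℝ} (hε : 0 < ε) {n : ℕ}
    (x : Fin n → EuclideanSpace ℝ (Fin 2)) (hx : ∀ i j, ‖x i - x j‖ ≤ 1)
    (R : Finset (Fin n × Fin n)) {N : ℕ} (hN : 2 / ε + 1 ≤ N) :
    #(R.image (Prod.map (fun i => gridCell (ε / 2) (x i))
      fun i => gridCell (ε / 2) (x i))) ≤ N ^ 4 := by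
  classical
  set J : Finset ℤ := Finset.Ico 0 (N : ℤ)
  have hN0 : (0 : ℤ) < N := by
    have : (0 : ℝ) < N := lt_of_lt_of_le (by positivity) hN
    exact_mod_cast this
  have hJ : #((J ×ˢ J) ×ˢ (J ×ˢ J)) = N ^ 4 := by
    simp only [card_product, J, Int.card_Ico, sub_zero, Int.toNat_natCast]
    ring
  rw [← hJ]
  refine card_image_le_of_determined R _
    (fun p => ((gridCell (ε / 2) (x p.1) 0 % N, gridCell (ε / 2) (x p.1) 1 % N),
      (gridCell (ε / 2) (x p.2) 0 % N, gridCell (ε / 2) (x p.2) 1 % N))) _ ?_ ?_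
  · intro p _
    simp only [mem_product, J, Finset.mem_Ico]
    exact ⟨⟨⟨Int.emod_nonneg _ hN0.ne', Int.emod_lt_of_pos _ hN0⟩,
      ⟨Int.emod_nonneg _ hN0.ne', Int.emod_lt_of_pos _ hN0⟩⟩,
      ⟨⟨Int.emod_nonneg _ hN0.ne', Int.emod_lt_of_pos _ hN0⟩,
      ⟨Int.emod_nonneg _ hN0.ne', Int.emod_lt_of_pos _ hN0⟩⟩⟩
  · intro p _ p' _ h
    simp only [Prod.mk.injEq] at h
    have key : ∀ i j s, gridCell (ε / 2) (x i) s % N = gridCell (ε / 2) (x j) s % N →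
        gridCell (ε / 2) (x i) s = gridCell (ε / 2) (x j) s := by
      intro i j s h
      refine Int.eq_of_emod_eq_of_abs_sub_lt h
        (abs_floor_div_sub_floor_div_lt (C := 2 / ε) (half_pos hε) ?_) hN
      rw [div_mul_div_cancel₀ hε.ne']
      simpa using (EuclideanSpace.abs_apply_le_norm (x i - x j) s).trans (hx i j)
    refine Prod.ext (funext fun s => ?_) (funext fun s => ?_)
    · fin_cases s
      exacts [key _ _ _ h.1.1, key _ _ _ h.1.2]
    · fin_cases s
      exacts [key _ _ _ h.2.1, key _ _ _ h.2.2]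

/-- The index of a coordinate of `v` of least absolute value. -/
noncomputable def minorIndex (v : EuclideanSpace ℝ (Fin 2)) : Fin 2 :=
  if |v 0| ≤ |v 1| then 0 else 1

theorem abs_minorIndex_le (v : EuclideanSpace ℝ (Fin 2)) :
    |v (minorIndex v)| ≤ |v (minorIndex v).rev| := by
  by_cases h : |v 0| ≤ |v 1|
  · rw [minorIndex, if_pos h]
    exact h
  · rw [minorIndex, if_neg h]
    exact (not_le.1 h).le

/-! ### Cell pairs realised by far pairs. -/

open Finset in
/-- In a set of diameter at most `1`, the pairs of points at distance at least `1 - ε` meet few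
pairs of cells: such a pair of cells is determined up to boundedly many choices by the direction
of the segment, with precision `ε`, and by one coordinate of an endpoint, which ranges in an
interval of length comparable to `√ε`. -/
theorem card_far_gridCell_pairs_le {ε : ℝ} (hε : 0 < ε) (hε' : ε ≤ 1 / 8) {n : ℕ}
    (x : Fin n → EuclideanSpace ℝ (Fin 2)) (hx : ∀ i j, ‖x i - x j‖ ≤ 1)
    (R : Finset (Fin n × Fin n)) (hR : ∀ p ∈ R, 1 - ε ≤ ‖x p.1 - x p.2‖)
    {M N : ℕ} (hM : 2 / ε + 1 ≤ M) (hN : 6 / √ε + 1 ≤ N) :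
    #(R.image (Prod.map (fun i => gridCell (ε / 2) (x i))
      fun i => gridCell (ε / 2) (x i))) ≤ 2 * 2 * (2 * M + 1) * N * 32 * 32 := by
  classical
  set Q : Fin n → Fin 2 → ℤ := fun i => gridCell (ε / 2) (x i)
  set T : Finset (((((Fin 2 × Bool) × ℤ) × ℤ) × ℤ) × ℤ) :=
    ((((univ ×ˢ univ) ×ˢ Finset.Icc (-(M : ℤ)) M) ×ˢ Finset.Ico 0 (N : ℤ)) ×ˢ
      Finset.Ico 0 ((32 : ℕ) : ℤ)) ×ˢ Finset.Ico 0 ((32 : ℕ) : ℤ)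
  have hT : #T = 2 * 2 * (2 * M + 1) * N * 32 * 32 := by
    simp only [T, card_product, Int.card_Ico, Int.card_Icc, Finset.card_univ, Fintype.card_fin,
      Fintype.card_bool, sub_zero, Int.toNat_natCast]
    congr 4
    omega
  have hN0 : (0 : ℤ) < N := by
    have : (0 : ℝ) < N := lt_of_lt_of_le (by positivity) hN
    exact_mod_cast this
  have h32 : (0 : ℤ) < (32 : ℕ) := by norm_num
  set σ : Fin n × Fin n → Fin 2 := fun p => minorIndex (x p.1 - x p.2)
  rw [← hT]
  refine card_image_le_of_determined R _
    -- The first three entries fix the direction, the fourth the position along the minor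
    -- coordinate; the two residues mod `32` resolve the bounded ambiguity left in the major
    -- coordinate.
    (fun p => (((((σ p, decide (0 ≤ (x p.1 - x p.2) (σ p).rev)),
      Q p.1 (σ p) - Q p.2 (σ p)), Q p.1 (σ p) % N),
      Q p.1 (σ p).rev % (32 : ℕ)),
      (Q p.1 (σ p).rev - Q p.2 (σ p).rev) % (32 : ℕ))) _ ?_ ?_
  · intro p _
    simp only [mem_product, T, Finset.mem_Ico, Finset.mem_Icc, mem_univ, true_and]
    refine ⟨⟨⟨?_, Int.emod_nonneg _ hN0.ne', Int.emod_lt_of_pos _ hN0⟩,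
      Int.emod_nonneg _ h32.ne', Int.emod_lt_of_pos _ h32⟩,
      Int.emod_nonneg _ h32.ne', Int.emod_lt_of_pos _ h32⟩
    have : |((Q p.1 (σ p) - Q p.2 (σ p) : ℤ) : ℝ)| < 2 / ε + 1 := by
      refine abs_floor_div_sub_floor_div_lt (half_pos hε) ?_
      rw [div_mul_div_cancel₀ hε.ne']
      simpa using (EuclideanSpace.abs_apply_le_norm (x p.1 - x p.2) (σ p)).trans (hx _ _)
    rw [← abs_le]
    exact_mod_cast this.le.trans hM
  · rintro ⟨i, j⟩ hp ⟨i', j'⟩ hp' h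
    simp only [Prod.mk.injEq, decide_eq_decide] at h
    obtain ⟨⟨⟨⟨⟨hσ, hsign⟩, hdiff⟩, hmod⟩, hmod'⟩, hmod''⟩ := h
    have hmin := abs_minorIndex_le (x i - x j)
    have hmin' := abs_minorIndex_le (x i' - x j')
    change |(x i - x j) (σ (i, j))| ≤ |(x i - x j) (σ (i, j)).rev| at hmin
    change |(x i' - x j') (σ (i', j'))| ≤ |(x i' - x j') (σ (i', j')).rev| at hmin'
    rw [← hσ] at hdiff hmod hmod' hmod'' hmin' hsign
    generalize σ (i, j) = s at *
    have hδ := half_pos hε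
    have hsq : ∀ a b, (x a s - x b s) ^ 2 + (x a s.rev - x b s.rev) ^ 2 ≤ 1 := by
      intro a b
      have := EuclideanSpace.norm_sq_eq_add_rev (x a - x b) s
      rw [PiLp.sub_apply, PiLp.sub_apply] at this
      rw [← this]
      exact pow_le_one₀ (norm_nonneg _) (hx a b)
    have hlow : ∀ a b, (a, b) ∈ R →
        (1 - ε) ^ 2 ≤ (x a s - x b s) ^ 2 + (x a s.rev - x b s.rev) ^ 2 := by
      intro a b hab
      have := EuclideanSpace.norm_sq_eq_add_rev (x a - x b) s
      rw [PiLp.sub_apply, PiLp.sub_apply] at this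
      rw [← this]
      exact pow_le_pow_left₀ (by linarith) (hR _ hab) 2
    simp only [PiLp.sub_apply] at hmin hmin' hsign
    -- Each floor difference locates a coordinate difference within one cell side, so equal ones
    -- leave an error of two sides, that is `ε`.
    have hqW : |(x i s - x j s) - (x i' s - x j' s)| ≤ ε := by
      have hc : ((⌊x i s / (ε / 2)⌋ : ℝ) - ⌊x j s / (ε / 2)⌋) =
          ⌊x i' s / (ε / 2)⌋ - ⌊x j' s / (ε / 2)⌋ := by exact_mod_cast hdiff
      have e : ∀ a, x a s = x a s / (ε / 2) * (ε / 2) := fun a =>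
        (div_mul_cancel₀ _ hδ.ne').symm
      rw [e i, e j, e i', e j', ← sub_mul, ← sub_mul, ← sub_mul, abs_mul, abs_of_pos hδ]
      have : |x i s / (ε / 2) - x j s / (ε / 2) - (x i' s / (ε / 2) - x j' s / (ε / 2))| ≤ 2 := by
        rw [abs_le]
        constructor <;>
        linarith [Int.floor_le (x i s / (ε / 2)), Int.lt_floor_add_one (x i s / (ε / 2)),
          Int.floor_le (x j s / (ε / 2)), Int.lt_floor_add_one (x j s / (ε / 2)),
          Int.floor_le (x i' s / (ε / 2)), Int.lt_floor_add_one (x i' s / (ε / 2)),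
          Int.floor_le (x j' s / (ε / 2)), Int.lt_floor_add_one (x j' s / (ε / 2))]
      nlinarith
    obtain ⟨hpP, hd₂, hd₁⟩ := near_diameters_close hε hε' hmin hmin' hsign hqW
      (hlow _ _ hp) (hsq i j) (hlow _ _ hp') (hsq i' j')
      (d₁ := x i s.rev - x i' s.rev) (d₂ := x i s - x i' s) (hsq i i')
      (by simpa using hsq i j')
      (by
        have := hsq i' j
        convert this using 2 <;> ring)
    -- `d₂ ^ 2 ≤ 7 * ε ≤ (3 * √ε) ^ 2`, and `3 * √ε` is `6 / √ε` cell sides.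
    have hQs : Q i s = Q i' s := by
      refine Int.eq_of_emod_eq_of_abs_sub_lt hmod
        (abs_floor_div_sub_floor_div_lt (C := 6 / √ε) hδ ?_) hN
      have hs : 0 < √ε := Real.sqrt_pos.2 hε
      have : 6 / √ε * (ε / 2) = 3 * √ε := by
        have := Real.mul_self_sqrt hε.le
        field_simp
        nlinarith
      rw [this]
      refine abs_le_of_sq_le_sq ?_ (by positivity)
      rw [mul_pow, Real.sq_sqrt hε.le]
      linarith
    -- `14 * ε` is `28` cell sides, so the cell indices differ by less than `29 ≤ 32`.
    have hQl : Q i s.rev = Q i' s.rev := by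
      refine Int.eq_of_emod_eq_of_abs_sub_lt hmod'
        (abs_floor_div_sub_floor_div_lt (C := 28) hδ ?_) (by norm_num)
      refine (hd₁ ?_).trans (by linarith)
      exact (abs_sub_lt_of_floor_div_eq hδ hQs).le.trans (by linarith)
    have hQs' : Q j s = Q j' s := by omega
    have hQl' : Q j s.rev = Q j' s.rev := by
      -- The first endpoints now agree within `ε / 2` and the direction vectors within `4 * ε`, in
      -- total at most `5 * ε`, or `10` cell sides.
      have hlt : |((⌊x j s.rev / (ε / 2)⌋ - ⌊x j' s.rev / (ε / 2)⌋ : ℤ) : ℝ)| < 10 + 1 := by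
        refine abs_floor_div_sub_floor_div_lt hδ ?_
        have := (abs_sub_lt_of_floor_div_eq hδ hQl).le
        rw [abs_le] at this hpP ⊢
        constructor <;> linarith
      have : Q i s.rev - Q j s.rev = Q i' s.rev - Q j' s.rev := by
        refine Int.eq_of_emod_eq_of_abs_sub_lt (C := 11) hmod'' ?_ (by norm_num)
        rw [hQl, sub_sub_sub_cancel_left, ← neg_sub, Int.cast_neg, abs_neg]
        have e : (11 : ℝ) = 10 + 1 := by norm_num
        rw [e]
        exact hlt
      omega
    have hs : ∀ f g : Fin 2 → ℤ, f s = g s → f s.rev = g s.rev → f = g := by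
      intro f g h h'
      funext t
      have : t = s ∨ t = s.rev := by
        have hdec : ∀ s t : Fin 2, t = s ∨ t = s.rev := by decide
        exact hdec s t
      rcases this with rfl | rfl
      exacts [h, h']
    exact Prod.ext (hs _ _ hQs hQl) (hs _ _ hQs' hQl')

/-! ### From the cell count to the inequality. -/

open Finset in
theorem card_far_gridCell_pairs_le_sq {ε : ℝ} (hε : 0 < ε) (hε' : ε ≤ 1 / 8) {n : ℕ}
    (x : Fin n → EuclideanSpace ℝ (Fin 2)) (hx : ∀ i j, ‖x i - x j‖ ≤ 1)
    (R : Finset (Fin n × Fin n)) (hR : ∀ p ∈ R, 1 - ε ≤ ‖x p.1 - x p.2‖) :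
    (#(R.image (Prod.map (fun i => gridCell (ε / 2) (x i))
      fun i => gridCell (ε / 2) (x i))) : ℝ) ≤ (512 * (ε ^ (3 / 4 : ℝ))⁻¹) ^ 2 := by
  have hs : 0 < √ε := Real.sqrt_pos.2 hε
  have hs1 : √ε ≤ 1 := Real.sqrt_le_one.2 (by linarith)
  have h := card_far_gridCell_pairs_le hε hε' x hx R hR (Nat.le_ceil _) (Nat.le_ceil _)
  have hM : (⌈2 / ε + 1⌉₊ : ℝ) ≤ 3 / ε := by
    refine (Nat.ceil_lt_add_one (by positivity)).le.trans ?_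
    rw [le_div_iff₀ hε]
    field_simp
    linarith
  have hN : (⌈6 / √ε + 1⌉₊ : ℝ) ≤ 8 / √ε := by
    refine (Nat.ceil_lt_add_one (by positivity)).le.trans ?_
    rw [le_div_iff₀ hs]
    field_simp
    linarith
  have hM' : 2 * (⌈2 / ε + 1⌉₊ : ℝ) + 1 ≤ 8 / ε := by
    have : 1 ≤ 2 / ε := by
      rw [le_div_iff₀ hε]
      linarith
    calc 2 * (⌈2 / ε + 1⌉₊ : ℝ) + 1 ≤ 2 * (3 / ε) + 2 / ε := by gcongr
      _ = 8 / ε := by ring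
  have hpow : (ε ^ (3 / 4 : ℝ)) ^ 2 = ε * √ε := by
    rw [← Real.rpow_natCast, ← Real.rpow_mul hε.le, Real.sqrt_eq_rpow]
    nth_rewrite 2 [← Real.rpow_one ε]
    rw [← Real.rpow_add hε]
    norm_num
  rw [mul_pow, inv_pow, hpow]
  calc _ ≤ ((2 * 2 * (2 * ⌈2 / ε + 1⌉₊ + 1) * ⌈6 / √ε + 1⌉₊ * 32 * 32 : ℕ) : ℝ) := by
        exact_mod_cast h
    _ = 2 * 2 * (2 * (⌈2 / ε + 1⌉₊ : ℝ) + 1) * ⌈6 / √ε + 1⌉₊ * 32 * 32 := by push_cast; ring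
    _ ≤ 2 * 2 * (8 / ε) * (8 / √ε) * 32 * 32 := by gcongr
    -- `4 * 8 * 8 * 32 ^ 2 = 512 ^ 2`.
    _ = 512 ^ 2 * (ε * √ε)⁻¹ := by
        field_simp
        norm_num

theorem theorem1 :
    ∀ ε₀ : ℝ, ε₀ < 1 →
      ∃ c : ℝ, 0 < c ∧
        ∀ ε : ℝ, 0 < ε → ε ≤ ε₀ →
          ∀ (n : ℕ) (x : Fin n → EuclideanSpace ℝ (Fin 2)),
            (∀ i j : Fin n, ‖x i - x j‖ ≤ 1) →
              ({p : Fin n × Fin n | ‖x p.1 - x p.2‖ ≤ ε}.ncard : ℝ) ≥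
                c * ε ^ (3 / 4 : ℝ) / (Real.log ε⁻¹) ^ (1 / 4 : ℝ) *
                  ({p : Fin n × Fin n | ‖x p.1 - x p.2‖ ≥ 1 - ε}.ncard : ℝ) := by
  intro ε₀ hε₀
  rcases le_or_gt ε₀ 0 with h0 | h0
  · exact ⟨1, one_pos, fun ε hε hε' => absurd (hε.trans_le hε') (not_lt.2 h0)⟩
  have hlog₀ : 0 < Real.log ε₀⁻¹ := Real.log_pos ((one_lt_inv₀ h0).2 hε₀)
  set ℓ := (Real.log ε₀⁻¹) ^ (1 / 4 : ℝ)
  have hℓ : 0 < ℓ := Real.rpow_pos_of_pos hlog₀ _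
  -- `512` comes from the cell count; `ℓ`, the least value of the logarithmic factor for `ε ≤ ε₀`,
  -- absorbs the division by it.
  refine ⟨ℓ / 512, by positivity, ?_⟩
  intro ε hε hεε₀ n x hx
  have hlog : ℓ ≤ (Real.log ε⁻¹) ^ (1 / 4 : ℝ) := by
    refine Real.rpow_le_rpow hlog₀.le (Real.log_le_log (inv_pos.2 h0) ?_) (by norm_num)
    exact inv_anti₀ hε hεε₀
  have hlogpos := hℓ.trans_le hlog
  have hεpos : 0 < ε ^ (3 / 4 : ℝ) := Real.rpow_pos_of_pos hε _
  classical
  set R : Finset (Fin n × Fin n) := {p | ‖x p.1 - x p.2‖ ≥ 1 - ε}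
  have hRcard : {p : Fin n × Fin n | ‖x p.1 - x p.2‖ ≥ 1 - ε}.ncard = R.card := by
    rw [← Set.ncard_coe_finset]
    simp [R]
  rw [hRcard, ge_iff_le]
  have hRK : (((R.image (Prod.map (fun i => gridCell (ε / 2) (x i))
      fun i => gridCell (ε / 2) (x i))).card : ℕ) : ℝ) ≤ (512 * (ε ^ (3 / 4 : ℝ))⁻¹) ^ 2 := by
    rcases le_or_gt ε (1 / 8) with h8 | h8
    · exact card_far_gridCell_pairs_le_sq hε h8 x hx R fun p hp => by simpa [R] using hp
    -- For `ε > 1 / 8` the crude count is enough: `2 / ε + 1 ≤ 17` and `17 ^ 4 ≤ 512 ^ 2`.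
    · have h := card_gridCell_pairs_le hε x hx R (N := 17) (by
        have : 2 / ε ≤ 16 := by
          rw [div_le_iff₀ hε]
          linarith
        push_cast
        linarith)
      have h1 : 1 ≤ (ε ^ (3 / 4 : ℝ))⁻¹ :=
        (one_le_inv₀ hεpos).2 (Real.rpow_le_one hε.le (by linarith) (by norm_num))
      calc _ ≤ ((17 ^ 4 : ℕ) : ℝ) := by exact_mod_cast h
        _ ≤ (512 * 1) ^ 2 := by norm_num
        _ ≤ _ := by gcongr
  have hmain := card_far_le hε x R (by positivity) hRK
  set S := ({p : Fin n × Fin n | ‖x p.1 - x p.2‖ ≤ ε}.ncard : ℝ)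
  set t := ε ^ (3 / 4 : ℝ)
  calc ℓ / 512 * t / (Real.log ε⁻¹) ^ (1 / 4 : ℝ) * R.card
      ≤ ℓ / 512 * t / ℓ * (512 * t⁻¹ * S) := by gcongr
    _ = S := by field_simp
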